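/- A (closed) simplicial surface $(X,<)$ is a countable set $X$ partitioned into non-empty sets $X_0$ (vertices), $X_1$ (edges), $X_2$ (faces), with an incidence relation ${<}\subseteq (X_0\times X_1)\cup(X_1\times X_2)\cup(X_0\times X_2)$ such that: (1) every edge has exactly two incident vertices; (2) every face has exactly three incident edges and exactly three incident vertices, and each of these vertices is incident to exactly two of these edges; (3) every edge is incident to exactly two faces; (4) for every vertex $V$, the faces incident to $V$ are finite in number, at least three, and can be arranged in a cyclic sequence $(F_1,\dots,F_m)$ without repetition such that $F_i$ and $F_{i+1}$ share an edge incident to $V$ for all $i$ (with $F_{m+1}=F_1$). A homomorphism of simplicial surfaces is a map that preserves $<$ and restricts, for every face $F$, to an isomorphism from the vertices and edges incident to $F$ onto those incident to the image of $F$; $\mathrm{Aut}(X)$ is the group of bijections $X\to X$ that are homomorphisms in both directions. The surface $X$ is vertex-faithful (that is, a simplicial complex in the usual sense) if the map $x\mapsto\{V\in X_0: V<x \text{ or } V=x\}$ is injective on $X$. It is connected if any two faces are joined by a chain of faces in which consecutive ones share an edge. **Theorem.** Let $G$ be a finite group generated by $g_1,\dots,g_n$ $(n\ge 0)$. Then there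 exists a finite connected simplicial surface $X$ with $\mathrm{Aut}(X)\cong G$ which, furthermore, is vertex-faithful if $\langle g_i\rangle\cap\langle g_1g_2\cdots g_n\rangle=\{1\}$ for all $i=1,\dots,n$. -/

import Mathlib

/-- A (closed) simplicial surface: a countable set `carrier`, partitioned by `dim` into the non-empty
sets of vertices (`dim = 0`), edges (`dim = 1`) and faces (`dim = 2`), with an incidence relation
`lt`.  Different edges, or different faces, may have the same vertices. -/
structure SimplicialSurface where
  carrier : Type
  countable_carrier : Countable carrier
  dim : carrier → Fin 3
  dim_surjective : Function.Surjective dim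
  lt : carrier → carrier → Prop
  /-- Incidence only relates a vertex to an edge, an edge to a face, or a vertex to a face. -/
  dim_lt_of_lt : ∀ a b, lt a b → dim a < dim b
  /-- Every edge has exactly two vertices. -/
  edge_vertices : ∀ e, dim e = 1 → {v | dim v = 0 ∧ lt v e}.ncard = 2
  /-- Every face has exactly three edges. -/
  face_edges : ∀ f, dim f = 2 → {e | dim e = 1 ∧ lt e f}.ncard = 3
  /-- Every face has exactly three vertices. -/
  face_vertices : ∀ f, dim f = 2 → {v | dim v = 0 ∧ lt v f}.ncard = 3
  /-- Every vertex of a face is incident to exactly two of the three edges of that face. -/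
  face_corners : ∀ f v, dim f = 2 → dim v = 0 → lt v f →
    {e | dim e = 1 ∧ lt e f ∧ lt v e}.ncard = 2
  /-- Every edge lies in exactly two faces. -/
  edge_faces : ∀ e, dim e = 1 → {f | dim f = 2 ∧ lt e f}.ncard = 2
  /-- Umbrella condition: the faces at a vertex `v` are finitely many, at least three, and can be
  arranged in a cyclic sequence in which consecutive faces share an edge incident to `v`. -/
  umbrella : ∀ v, dim v = 0 → ∃ n : ℕ, 3 ≤ n ∧ ∃ u : ZMod n → carrier,
    Function.Injective u ∧ Set.range u = {f | dim f = 2 ∧ lt v f} ∧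
    ∀ i, ∃ e, dim e = 1 ∧ lt v e ∧ lt e (u i) ∧ lt e (u (i + 1))

namespace SimplicialSurface

/-- A homomorphism of simplicial surfaces preserves incidence and restricts, for every face `F`,
to an isomorphism from the vertices and edges incident to `F` onto those incident to its image. -/
def IsHom (X Y : SimplicialSurface) (φ : X.carrier → Y.carrier) : Prop :=
  (∀ a b, X.lt a b → Y.lt (φ a) (φ b)) ∧
  ∀ F, X.dim F = 2 →
    Set.BijOn φ {a | X.lt a F} {b | Y.lt b (φ F)} ∧
    ∀ a b, X.lt a F → X.lt b F → (X.lt a b ↔ Y.lt (φ a) (φ b))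

theorem IsHom.dim_face {X Y : SimplicialSurface} {φ : X.carrier → Y.carrier} (h : IsHom X Y φ)
    {F : X.carrier} (hF : X.dim F = 2) : Y.dim (φ F) = 2 := by
  have h3 := X.face_edges F hF
  obtain ⟨e, he, heF⟩ : {e | X.dim e = 1 ∧ X.lt e F}.Nonempty :=
    Set.nonempty_of_ncard_ne_zero (by omega)
  have h2 := X.edge_vertices e he
  obtain ⟨v, hv, hve⟩ : {v | X.dim v = 0 ∧ X.lt v e}.Nonempty :=
    Set.nonempty_of_ncard_ne_zero (by omega)
  have h4 := Y.dim_lt_of_lt _ _ (h.1 _ _ heF)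
  have h5 := Y.dim_lt_of_lt _ _ (h.1 _ _ hve)
  omega

theorem IsHom.comp {X Y Z : SimplicialSurface} {φ : X.carrier → Y.carrier}
    {ψ : Y.carrier → Z.carrier} (hψ : IsHom Y Z ψ) (hφ : IsHom X Y φ) : IsHom X Z (ψ ∘ φ) := by
  refine ⟨fun a b hab => hψ.1 _ _ (hφ.1 _ _ hab), fun F hF => ?_⟩
  have h1 := hφ.2 F hF
  have h2 := hψ.2 (φ F) (hφ.dim_face hF)
  exact ⟨h2.1.comp h1.1, fun a b ha hb =>
    (h1.2 a b ha hb).trans (h2.2 _ _ (hφ.1 _ _ ha) (hφ.1 _ _ hb))⟩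

theorem IsHom.id (X : SimplicialSurface) : IsHom X X _root_.id :=
  ⟨fun _ _ h => h, fun _ _ => ⟨Set.bijOn_id _, fun _ _ _ _ => Iff.rfl⟩⟩

/-- The automorphism group: bijections of the surface that are homomorphisms in both directions. -/
def Aut (X : SimplicialSurface) : Subgroup (Equiv.Perm X.carrier) where
  carrier := {φ | IsHom X X φ ∧ IsHom X X φ.symm}
  one_mem' := ⟨IsHom.id X, IsHom.id X⟩
  mul_mem' := fun ha hb => ⟨ha.1.comp hb.1, hb.2.comp ha.2⟩
  inv_mem' := fun ha => ⟨ha.2, ha.1⟩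

/-- `X₀(x)`: the vertices that are incident or equal to `x`. -/
def vertexSet (X : SimplicialSurface) (x : X.carrier) : Set X.carrier :=
  {v | X.dim v = 0 ∧ (X.lt v x ∨ v = x)}

/-- A surface is vertex-faithful if its elements are determined by their vertices, so that it is a
simplicial complex in the conventional sense. -/
def VertexFaithful (X : SimplicialSurface) : Prop :=
  Function.Injective X.vertexSet

/-- Two faces are adjacent if they share an edge. -/
def FaceAdj (X : SimplicialSurface) (F F' : X.carrier) : Prop :=
  X.dim F = 2 ∧ X.dim F' = 2 ∧ ∃ e, X.dim e = 1 ∧ X.lt e F ∧ X.lt e F'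

/-- A surface is connected if any two faces are joined by a chain of adjacent faces, that is, if
its face graph is connected. -/
def Connected (X : SimplicialSurface) : Prop :=
  ∀ F F', X.dim F = 2 → X.dim F' = 2 → Relation.ReflTransGen X.FaceAdj F F'

end SimplicialSurface

/-! ### Cells of a simplicial surface -/

namespace SimplicialSurface

variable {X : SimplicialSurface}

/-! All surfaces are unramified coverings of one fixed vertex-faithful surface `S` of genus two,
whose vertices can be told apart by degrees and adjacencies. The fundamental group of `S` maps onto
the free group of rank two, so any two permutations `σ`, `τ` of a set `M` define a covering with
fibre `M`, with no relation to check.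

Automorphisms of the covering preserve every fibre (`Voltage.snd_of_mem_Aut`), hence amount to
permutations of `M` commuting with `σ` and `τ` (`Voltage.exists_of_mem_Aut`,
`Voltage.deck_mem_Aut`). The covering inherits vertex-faithfulness from `S`, and is connected when
`σ`, `τ` act transitively.

It remains to realize a finite group `K` as the centralizer of a transitive pair. On `K × K` let `σ`
permute the second coordinate in one cycle and let `τ (h, x) = (h * x, x)`. Left multiplications on
the first coordinate commute with both; conversely, a commuting map sends the `τ`-fixed point `(1,
1)` to some `(k, 1)`, and transitivity determines the rest. -/

theorem exists_face_of_vertex {v : X.carrier} (hv : X.dim v = 0) :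
    ∃ f, X.dim f = 2 ∧ X.lt v f := by
  obtain ⟨n, -, u, -, hu, -⟩ := X.umbrella v hv
  exact ⟨u 0, (Set.ext_iff.1 hu (u 0)).1 ⟨0, rfl⟩⟩

theorem exists_face_of_edge {e : X.carrier} (he : X.dim e = 1) :
    ∃ f, X.dim f = 2 ∧ X.lt e f :=
  Set.nonempty_of_ncard_ne_zero ((X.edge_faces e he).trans_ne (by decide))

theorem exists_vertex_of_edge {e : X.carrier} (he : X.dim e = 1) :
    ∃ v, X.dim v = 0 ∧ X.lt v e :=
  Set.nonempty_of_ncard_ne_zero ((X.edge_vertices e he).trans_ne (by decide))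

theorem exists_vertex_of_face {f : X.carrier} (hf : X.dim f = 2) :
    ∃ v, X.dim v = 0 ∧ X.lt v f :=
  Set.nonempty_of_ncard_ne_zero ((X.face_vertices f hf).trans_ne (by decide))

theorem dim_cases (x : X.carrier) : X.dim x = 0 ∨ X.dim x = 1 ∨ X.dim x = 2 := by omega

theorem vertexSet_nonempty (x : X.carrier) : (X.vertexSet x).Nonempty := by
  rcases X.dim_cases x with h | h | h
  · exact ⟨x, h, Or.inr rfl⟩
  · obtain ⟨v, hv, hvx⟩ := exists_vertex_of_edge h
    exact ⟨v, hv, Or.inl hvx⟩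
  · obtain ⟨v, hv, hvx⟩ := exists_vertex_of_face h
    exact ⟨v, hv, Or.inl hvx⟩

theorem exists_face_ge (x : X.carrier) : ∃ f, X.dim f = 2 ∧ (x = f ∨ X.lt x f) := by
  rcases X.dim_cases x with h | h | h
  · obtain ⟨f, hf, hxf⟩ := exists_face_of_vertex h
    exact ⟨f, hf, Or.inr hxf⟩
  · obtain ⟨f, hf, hxf⟩ := exists_face_of_edge h
    exact ⟨f, hf, Or.inr hxf⟩
  · exact ⟨x, h, Or.inl rfl⟩

theorem not_lt_self (x : X.carrier) : ¬ X.lt x x := fun h => lt_irrefl _ (X.dim_lt_of_lt _ _ h)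

/-! ### Invariants of automorphisms -/

section Aut

theorem lt_iff_of_mem_Aut {φ : Equiv.Perm X.carrier} (h : φ ∈ X.Aut) (a b : X.carrier) :
    X.lt (φ a) (φ b) ↔ X.lt a b :=
  ⟨fun hab => by simpa using h.2.1 _ _ hab, h.1.1 a b⟩

theorem mem_Aut_of_lt_iff {φ : Equiv.Perm X.carrier}
    (h : ∀ a b, X.lt (φ a) (φ b) ↔ X.lt a b) : φ ∈ X.Aut := by
  have key : ∀ ψ : Equiv.Perm X.carrier, (∀ a b, X.lt (ψ a) (ψ b) ↔ X.lt a b) → IsHom X X ψ := by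
    refine fun ψ hψ => ⟨fun a b => (hψ a b).2, fun F _ => ⟨⟨fun a ha => (hψ a F).2 ha,
      ψ.injective.injOn, fun b hb => ⟨ψ.symm b, (hψ _ F).1 ?_, by simp⟩⟩,
      fun a b _ _ => (hψ a b).symm⟩⟩
    simpa using hb
  exact ⟨key φ h, key φ.symm fun a b => by simpa using (h (φ.symm a) (φ.symm b)).symm⟩

theorem exists_chain (x : X.carrier) : ∃ v e f, X.lt v e ∧ X.lt e f ∧ (x = v ∨ x = e ∨ x = f) := by
  rcases X.dim_cases x with h | h | h
  · obtain ⟨n, -, u, -, -, he⟩ := X.umbrella x h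
    obtain ⟨e, -, hxe, hef, -⟩ := he 0
    exact ⟨x, e, _, hxe, hef, Or.inl rfl⟩
  · obtain ⟨v, -, hv⟩ := exists_vertex_of_edge h
    obtain ⟨f, -, hf⟩ := exists_face_of_edge h
    exact ⟨v, x, f, hv, hf, Or.inr (Or.inl rfl)⟩
  · obtain ⟨e, he, hex⟩ : {e | X.dim e = 1 ∧ X.lt e x}.Nonempty :=
      Set.nonempty_of_ncard_ne_zero ((X.face_edges x h).trans_ne (by decide))
    obtain ⟨v, -, hv⟩ := exists_vertex_of_edge he
    exact ⟨v, e, x, hv, hex, Or.inr (Or.inr rfl)⟩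

/-- Every cell lies in a flag of three cells, and only one strictly increasing triple of dimensions
exists. -/
theorem dim_of_mem_Aut {φ : Equiv.Perm X.carrier} (h : φ ∈ X.Aut) (x : X.carrier) :
    X.dim (φ x) = X.dim x := by
  obtain ⟨v, e, f, hve, hef, hx⟩ := X.exists_chain x
  have h1 := X.dim_lt_of_lt _ _ hve
  have h2 := X.dim_lt_of_lt _ _ hef
  have h3 := X.dim_lt_of_lt _ _ (h.1.1 _ _ hve)
  have h4 := X.dim_lt_of_lt _ _ (h.1.1 _ _ hef)
  rcases hx with rfl | rfl | rfl <;> omega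

theorem vertexSet_of_mem_Aut {φ : Equiv.Perm X.carrier} (h : φ ∈ X.Aut) (x : X.carrier) :
    X.vertexSet (φ x) = φ '' X.vertexSet x := by
  ext v
  obtain ⟨v, rfl⟩ := φ.surjective v
  rw [φ.injective.mem_set_image]
  simp only [vertexSet, Set.mem_ofPred_eq, dim_of_mem_Aut h, lt_iff_of_mem_Aut h,
    φ.injective.eq_iff]

/-- The number of faces at a cell. -/
noncomputable def degree (X : SimplicialSurface) (v : X.carrier) : ℕ :=
  {f | X.dim f = 2 ∧ X.lt v f}.ncard

theorem degree_of_mem_Aut {φ : Equiv.Perm X.carrier} (h : φ ∈ X.Aut) (v : X.carrier) :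
    X.degree (φ v) = X.degree v := by
  rw [degree, degree, ← Set.ncard_image_of_injective {f | X.dim f = 2 ∧ X.lt v f} φ.injective]
  congr 1
  ext f
  obtain ⟨f, rfl⟩ := φ.surjective f
  rw [φ.injective.mem_set_image]
  simp only [Set.mem_ofPred_eq, dim_of_mem_Aut h, lt_iff_of_mem_Aut h]

end Aut

/-! ### Connectivity through incidence -/

section Connected

theorem FaceAdj.symm {F F' : X.carrier} (h : X.FaceAdj F F') : X.FaceAdj F' F :=
  ⟨h.2.1, h.1, h.2.2.imp fun _ he => ⟨he.1, he.2.2, he.2.1⟩⟩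

theorem reflTransGen_faceAdj_symm {F F' : X.carrier} (h : Relation.ReflTransGen X.FaceAdj F F') :
    Relation.ReflTransGen X.FaceAdj F' F :=
  have : Std.Symm X.FaceAdj := ⟨fun _ _ => FaceAdj.symm⟩
  Relation.ReflTransGen.stdSymm.symm _ _ h

/-- For a vertex `x` one walks around its umbrella; this lets chains of incidences replace chains of
faces. -/
theorem reflTransGen_faceAdj_of_le {x F F' : X.carrier} (hF : X.dim F = 2) (hF' : X.dim F' = 2)
    (h : x = F ∨ X.lt x F) (h' : x = F' ∨ X.lt x F') :
    Relation.ReflTransGen X.FaceAdj F F' := by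
  rcases X.dim_cases x with hx | hx | hx
  · have hlt : X.lt x F := h.resolve_left (by rintro rfl; simp [hx] at hF)
    have hlt' : X.lt x F' := h'.resolve_left (by rintro rfl; simp [hx] at hF')
    obtain ⟨n, hn, u, -, hu, he⟩ := X.umbrella x hx
    have : NeZero n := ⟨by omega⟩
    obtain ⟨i, rfl⟩ := (Set.ext_iff.1 hu F).2 ⟨hF, hlt⟩
    obtain ⟨j, rfl⟩ := (Set.ext_iff.1 hu F').2 ⟨hF', hlt'⟩
    have hd : ∀ k, X.dim (u k) = 2 := fun k => ((Set.ext_iff.1 hu (u k)).1 ⟨k, rfl⟩).1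
    have key : ∀ k : ℕ, Relation.ReflTransGen X.FaceAdj (u i) (u (i + k)) := by
      intro k
      induction k with
      | zero => simpa using Relation.ReflTransGen.refl
      | succ k ih =>
        obtain ⟨e, he1, -, he2, he3⟩ := he (i + k)
        refine ih.tail ⟨hd _, hd _, e, he1, he2, ?_⟩
        simpa [add_assoc] using he3
    have := key (j - i).val
    rwa [ZMod.natCast_zmod_val, add_sub_cancel] at this
  · have hlt : X.lt x F := h.resolve_left (by rintro rfl; simp [hx] at hF)
    have hlt' : X.lt x F' := h'.resolve_left (by rintro rfl; simp [hx] at hF')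
    exact .single ⟨hF, hF', x, hx, hlt, hlt'⟩
  · have hmax : ∀ y, ¬ X.lt x y := fun y hy => by
      have := X.dim_lt_of_lt _ _ hy
      omega
    rw [← h.resolve_right (hmax _), ← h'.resolve_right (hmax _)]

theorem connected_of_eqvGen (htrans : ∀ a b c, X.lt a b → X.lt b c → X.lt a c)
    (h : ∀ x y, Relation.EqvGen X.lt x y) : X.Connected := by
  have key : ∀ x y, Relation.EqvGen X.lt x y → ∀ F F', X.dim F = 2 → X.dim F' = 2 →
      (x = F ∨ X.lt x F) → (y = F' ∨ X.lt y F') → Relation.ReflTransGen X.FaceAdj F F' := by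
    intro x y hxy
    induction hxy with
    | rel x y hxy =>
      intro F F' hF hF' hx hy
      refine reflTransGen_faceAdj_of_le hF hF' hx (Or.inr ?_)
      rcases hy with rfl | hy
      · exact hxy
      · exact htrans _ _ _ hxy hy
    | refl x => exact fun F F' hF hF' hx hy => reflTransGen_faceAdj_of_le hF hF' hx hy
    | symm x y _ ih =>
      exact fun F F' hF hF' hx hy => reflTransGen_faceAdj_symm (ih F' F hF' hF hy hx)
    | trans x y z _ _ ih ih' =>
      intro F F' hF hF' hx hz
      obtain ⟨f, hf, hyf⟩ := exists_face_ge y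
      exact (ih F f hF hf hx hyf).trans (ih' f F' hf hF' hyf hz)
  exact fun F F' hF hF' => key F F' (h F F') F F' hF hF' (Or.inl rfl) (Or.inl rfl)

end Connected

/-! ### Coverings defined by voltages -/

section Cover

variable {S : SimplicialSurface} {M : Type}

/-- A voltage assignment on a simplicial surface `S` with values in the permutations of `M`: it is
multiplicative along flags, so that it defines a covering of `S` with fibre `M`. -/
structure Voltage (S : SimplicialSurface) (M : Type) where
  toFun : S.carrier → S.carrier → Equiv.Perm M
  mul_eq : ∀ a b c, S.lt a b → S.lt b c → S.lt a c → toFun a b * toFun b c = toFun a c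

namespace Voltage

variable (w : Voltage S M)

/-- Incidence in the covering surface. -/
def lt (x y : M × S.carrier) : Prop := S.lt x.2 y.2 ∧ x.1 = w.toFun x.2 y.2 y.1

/-- Each cell below `b` has exactly one lift below `(m, b)`, since the voltage determines its fibre
coordinate. -/
theorem ncard_below (P : S.carrier → Prop) (m : M) (b : S.carrier) :
    {x : M × S.carrier | P x.2 ∧ w.lt x (m, b)}.ncard = {a | P a ∧ S.lt a b}.ncard := by
  rw [← Set.ncard_image_of_injective (f := fun a => (w.toFun a b m, a)) _
    fun a a' h => (Prod.ext_iff.1 h).2]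
  congr 1
  ext ⟨k, a⟩
  simp only [lt, Set.mem_ofPred_eq, Set.mem_image, Prod.mk.injEq]
  constructor
  · rintro ⟨h1, h2, rfl⟩
    exact ⟨a, ⟨h1, h2⟩, rfl, rfl⟩
  · rintro ⟨a, ⟨h1, h2⟩, rfl, rfl⟩
    exact ⟨h1, h2, rfl⟩

theorem ncard_above (P : S.carrier → Prop) (m : M) (b : S.carrier) :
    {x : M × S.carrier | P x.2 ∧ w.lt (m, b) x}.ncard = {a | P a ∧ S.lt b a}.ncard := by
  rw [← Set.ncard_image_of_injective (f := fun a => ((w.toFun b a).symm m, a)) _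
    fun a a' h => (Prod.ext_iff.1 h).2]
  congr 1
  ext ⟨k, a⟩
  simp only [lt, Set.mem_ofPred_eq, Set.mem_image, Prod.mk.injEq]
  constructor
  · rintro ⟨h1, h2, rfl⟩
    exact ⟨a, ⟨h1, h2⟩, by simp, rfl⟩
  · rintro ⟨a, ⟨h1, h2⟩, rfl, rfl⟩
    exact ⟨h1, h2, by simp⟩

/-- The covering surface with fibre `M` defined by a voltage assignment. -/
abbrev cover [Countable M] [Nonempty M] : SimplicialSurface where
  carrier := M × S.carrier
  countable_carrier := by
    have := S.countable_carrier
    infer_instance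
  dim x := S.dim x.2
  dim_surjective := S.dim_surjective.comp Prod.snd_surjective
  lt := w.lt
  dim_lt_of_lt _ _ h := S.dim_lt_of_lt _ _ h.1
  edge_vertices := fun ⟨m, e⟩ he => (w.ncard_below _ m e).trans (S.edge_vertices e he)
  face_edges := fun ⟨m, f⟩ hf => (w.ncard_below _ m f).trans (S.face_edges f hf)
  face_vertices := fun ⟨m, f⟩ hf => (w.ncard_below _ m f).trans (S.face_vertices f hf)
  face_corners := by
    rintro ⟨m, f⟩ ⟨k, v⟩ hf hv ⟨hvf, hk⟩
    refine Eq.trans ?_ (S.face_corners f v hf hv hvf)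
    have := w.ncard_below (fun e => S.dim e = 1 ∧ S.lt v e) m f
    simp only [and_assoc, and_comm (a := S.lt v _)] at this
    rw [← this]
    congr 1
    ext ⟨l, e⟩
    simp only [lt, Set.mem_ofPred_eq] at hk ⊢
    constructor
    · rintro ⟨h1, ⟨h2, h3⟩, h4, -⟩
      exact ⟨h1, ⟨h2, h3⟩, h4⟩
    · rintro ⟨h1, ⟨h2, h3⟩, h4⟩
      refine ⟨h1, ⟨h2, h3⟩, h4, ?_⟩
      -- Multiplicativity along the flag makes the incidence of the lifted vertex and edge
      -- automatic.
      rw [h3, hk, ← w.mul_eq v e f h4 h2 hvf, Equiv.Perm.mul_apply]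
  edge_faces := fun ⟨m, e⟩ he => (w.ncard_above _ m e).trans (S.edge_faces e he)
  umbrella := by
    rintro ⟨m, v⟩ hv
    obtain ⟨n, hn, u, hinj, hu, he⟩ := S.umbrella v hv
    have hlt : ∀ i, S.lt v (u i) := fun i => ((Set.ext_iff.1 hu (u i)).1 ⟨i, rfl⟩).2
    refine ⟨n, hn, fun i => ((w.toFun v (u i)).symm m, u i),
      fun i j hij => hinj (Prod.ext_iff.1 hij).2, ?_, fun i => ?_⟩
    · ext ⟨k, f⟩
      have := Set.ext_iff.1 hu f
      simp only [Set.mem_range, Set.mem_ofPred_eq, lt, Prod.mk.injEq] at this ⊢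
      rw [← and_assoc, ← this]
      constructor
      · rintro ⟨i, rfl, rfl⟩
        exact ⟨⟨i, rfl⟩, by simp⟩
      · rintro ⟨⟨i, rfl⟩, rfl⟩
        exact ⟨i, by simp, rfl⟩
    · obtain ⟨e, he1, hve, hei, hei'⟩ := he i
      have key : ∀ j, S.lt e (u j) →
          w.lt ((w.toFun v e).symm m, e) ((w.toFun v (u j)).symm m, u j) := fun j hj =>
        ⟨hj, by rw [Equiv.symm_apply_eq, ← Equiv.Perm.mul_apply, w.mul_eq _ _ _ hve hj (hlt j),
          Equiv.apply_symm_apply]⟩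
      exact ⟨((w.toFun v e).symm m, e), he1, ⟨hve, by simp⟩, key i hei, key (i + 1) hei'⟩

variable [Countable M] [Nonempty M]

theorem finite_cover [Finite M] [Finite S.carrier] : Finite w.cover.carrier :=
  inferInstanceAs (Finite (M × S.carrier))

theorem snd_image_vertexSet (x : w.cover.carrier) :
    (fun y : w.cover.carrier => y.2) '' w.cover.vertexSet x = S.vertexSet x.2 := by
  obtain ⟨m, a⟩ := x
  ext v
  constructor
  · rintro ⟨⟨k, v⟩, ⟨h1, h2 | h2⟩, rfl⟩
    · exact ⟨h1, Or.inl h2.1⟩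
    · exact ⟨h1, Or.inr (Prod.ext_iff.1 h2).2⟩
  · rintro ⟨h1, h2 | rfl⟩
    · exact ⟨(w.toFun v a m, v), ⟨h1, Or.inl ⟨h2, rfl⟩⟩, rfl⟩
    · exact ⟨(m, v), ⟨h1, Or.inr rfl⟩, rfl⟩

theorem vertexFaithful_cover (hS : S.VertexFaithful) : w.cover.VertexFaithful := by
  intro x y hxy
  have h : x.2 = y.2 := hS (by rw [← snd_image_vertexSet, ← snd_image_vertexSet, hxy])
  obtain ⟨m, a⟩ := x
  obtain ⟨k, b⟩ := y
  obtain rfl : a = b := h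
  obtain ⟨⟨l, v⟩, hv⟩ := vertexSet_nonempty (X := w.cover) (m, a)
  have hv' := hv
  rw [hxy] at hv'
  rcases hv.2 with h1 | h1 <;> rcases hv'.2 with h2 | h2
  · exact Prod.ext ((w.toFun v a).injective (h1.2.symm.trans h2.2)) rfl
  · have h3 := h1.1
    rw [(Prod.ext_iff.1 h2).2] at h3
    exact absurd h3 (S.not_lt_self _)
  · have h3 := h2.1
    rw [(Prod.ext_iff.1 h1).2] at h3
    exact absurd h3 (S.not_lt_self _)
  · exact h1.symm.trans h2

/-- `hS` replaces a spanning tree of trivial voltages, and `hM` expresses transitivity of the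
voltages on the fibre. -/
theorem connected_cover (htrans : ∀ a b c, S.lt a b → S.lt b c → S.lt a c)
    (hS : ∀ {α : Type} (ψ : S.carrier → α),
      (∀ a b, S.lt a b → w.toFun a b = 1 → ψ a = ψ b) → ∀ a b, ψ a = ψ b)
    (hM : ∀ {α : Type} (q : M → α),
      (∀ a b m, S.lt a b → q (w.toFun a b m) = q m) → ∀ m m', q m = q m') :
    w.cover.Connected := by
  refine connected_of_eqvGen (fun x y z hxy hyz => ?_) ?_
  · have h := htrans _ _ _ hxy.1 hyz.1
    exact ⟨h, by rw [hxy.2, hyz.2, ← Equiv.Perm.mul_apply, w.mul_eq _ _ _ hxy.1 hyz.1 h]⟩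
  -- `q` records connected components; by `hS` it does not depend on the cell, so `hM` applies to
  -- it.
  · let q : S.carrier → M → Quot w.lt := fun a m => Quot.mk _ (m, a)
    have hq : ∀ a b m, S.lt a b → q a (w.toFun a b m) = q b m := fun a b m h =>
      Quot.sound ⟨h, rfl⟩
    have h1 : ∀ a b, q a = q b := hS q fun a b hab hw => by
      funext m
      simpa [hw] using hq a b m hab
    rintro ⟨m, a⟩ ⟨k, b⟩
    have h2 : ∀ m m', q b m = q b m' := hM (q b) fun c d m hcd => by
      rw [h1 b c, hq c d m hcd, h1 d c]
    exact Quot.eqvGen_exact ((congrFun (h1 a b) m).trans (h2 m k))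

theorem degree_cover (x : w.cover.carrier) : w.cover.degree x = S.degree x.2 :=
  w.ncard_above (fun f => S.dim f = 2) x.1 x.2

/-- If the vertices of `S` can be told apart one after the other by their degrees and by their
adjacency to those recognized before, then automorphisms of a covering preserve the fibres. -/
theorem snd_of_mem_Aut (hS : S.VertexFaithful) (r : S.carrier → ℕ)
    (hr : ∀ v v', S.dim v = 0 → S.dim v' = 0 → S.degree v' = S.degree v →
      (∀ u, S.dim u = 0 → r u < r v → (∃ e, S.lt u e ∧ S.lt v e) → ∃ e, S.lt u e ∧ S.lt v' e) →
      v' = v)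
    {φ : Equiv.Perm w.cover.carrier} (hφ : φ ∈ w.cover.Aut) (x : w.cover.carrier) :
    (φ x).2 = x.2 := by
  have hd : ∀ x : w.cover.carrier, S.dim (φ x).2 = S.dim x.2 := dim_of_mem_Aut hφ
  have hv : ∀ (n : ℕ) (x : w.cover.carrier), r x.2 = n → S.dim x.2 = 0 → (φ x).2 = x.2 := by
    intro n
    induction n using Nat.strong_induction_on with
    | _ n ih =>
      rintro ⟨m, v⟩ rfl hx
      refine hr _ _ hx ((hd _).trans hx) ?_ ?_
      · exact (w.degree_cover _).symm.trans ((degree_of_mem_Aut hφ _).trans (w.degree_cover _))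
      · rintro u hu hlt ⟨e, hue, hve⟩
        let y : w.cover.carrier := ((w.toFun v e).symm m, e)
        have h1 : w.cover.lt (m, v) y := ⟨hve, by simp [y]⟩
        have h2 : w.cover.lt (w.toFun u e y.1, u) y := ⟨hue, rfl⟩
        have h3 := ((lt_iff_of_mem_Aut hφ _ _).2 h2).1
        rw [ih _ hlt (w.toFun u e y.1, u) rfl hu] at h3
        exact ⟨_, h3, ((lt_iff_of_mem_Aut hφ _ _).2 h1).1⟩
  -- All vertices are settled; a remaining cell is determined by the projection of its vertex set.
  apply hS
  rw [← snd_image_vertexSet, ← snd_image_vertexSet, vertexSet_of_mem_Aut hφ, Set.image_image]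
  exact Set.image_congr fun y hy => hv _ y rfl hy.1

/-- A fibre-preserving automorphism acts on each fibre by some map of `M`; these maps agree along
trivial voltages, hence everywhere by `hS`. -/
theorem exists_of_mem_Aut
    (hS : ∀ {α : Type} (ψ : S.carrier → α),
      (∀ a b, S.lt a b → w.toFun a b = 1 → ψ a = ψ b) → ∀ a b, ψ a = ψ b)
    {φ : Equiv.Perm w.cover.carrier} (hφ : φ ∈ w.cover.Aut)
    (hsnd : ∀ x : w.cover.carrier, (φ x).2 = x.2) :
    ∃ ψ : M → M, (∀ m a, φ (m, a) = (ψ m, a)) ∧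
      ∀ a b m, S.lt a b → ψ (w.toFun a b m) = w.toFun a b (ψ m) := by
  let ψ : S.carrier → M → M := fun a m => (φ (m, a)).1
  have hψ : ∀ a b m, S.lt a b → ψ a (w.toFun a b m) = w.toFun a b (ψ b m) := by
    intro a b m hab
    have h : w.cover.lt (w.toFun a b m, a) (m, b) := ⟨hab, rfl⟩
    have h1 := ((lt_iff_of_mem_Aut hφ _ _).2 h).2
    rwa [hsnd, hsnd] at h1
  have h1 : ∀ a b, ψ a = ψ b := hS ψ fun a b hab hw => by
    funext m
    simpa [hw] using hψ a b m hab
  obtain ⟨a₀, -⟩ := S.dim_surjective 0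
  refine ⟨ψ a₀, fun m a => Prod.ext (congrFun (h1 a a₀) m) (hsnd (m, a)), fun a b m hab => ?_⟩
  rw [h1 a₀ a, hψ a b m hab, h1 b a]

/-- The automorphism of a covering given by a permutation of the fibre that commutes with all
voltages. -/
def deck (ψ : Equiv.Perm M) : Equiv.Perm w.cover.carrier := Equiv.prodCongr ψ (Equiv.refl _)

theorem deck_mem_Aut {ψ : Equiv.Perm M}
    (hψ : ∀ a b m, S.lt a b → ψ (w.toFun a b m) = w.toFun a b (ψ m)) : w.deck ψ ∈ w.cover.Aut := by
  refine mem_Aut_of_lt_iff fun x y => and_congr_right fun h => ?_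
  obtain ⟨m, a⟩ := x
  obtain ⟨k, b⟩ := y
  change ψ m = w.toFun a b (ψ k) ↔ m = w.toFun a b k
  rw [← hψ a b k h, ψ.injective.eq_iff]

theorem nonempty_Aut_cover_mulEquiv {K : Type*} [Group K] (ρ : K →* Equiv.Perm M)
    (hinj : Function.Injective ρ)
    (hρ : ∀ k a b m, S.lt a b → ρ k (w.toFun a b m) = w.toFun a b (ρ k m))
    (hsurj : ∀ ψ : M → M, (∀ a b m, S.lt a b → ψ (w.toFun a b m) = w.toFun a b (ψ m)) →
      ∃ k, ∀ m, ρ k m = ψ m)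
    (hS : ∀ {α : Type} (ψ : S.carrier → α),
      (∀ a b, S.lt a b → w.toFun a b = 1 → ψ a = ψ b) → ∀ a b, ψ a = ψ b)
    (hsnd : ∀ φ ∈ w.cover.Aut, ∀ x : w.cover.carrier, (φ x).2 = x.2) :
    Nonempty (w.cover.Aut ≃* K) := by
  let Φ : K →* w.cover.Aut :=
    { toFun := fun k => ⟨w.deck (ρ k), w.deck_mem_Aut (hρ k)⟩
      map_one' := by
        simp only [map_one]
        rfl
      map_mul' := fun k l => by
        ext x
        · simp [deck]
        · rfl }
  refine ⟨(MulEquiv.ofBijective Φ ⟨fun k l hkl => hinj ?_, ?_⟩).symm⟩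
  · ext m
    obtain ⟨a₀, -⟩ := S.dim_surjective 0
    have h : w.deck (ρ k) = w.deck (ρ l) := congrArg Subtype.val hkl
    exact (Prod.ext_iff.1 (DFunLike.congr_fun h (m, a₀))).1
  · rintro ⟨φ, hφ⟩
    obtain ⟨ψ, h1, h2⟩ := w.exists_of_mem_Aut hS hφ (hsnd φ hφ)
    obtain ⟨k, hk⟩ := hsurj ψ h2
    refine ⟨k, Subtype.ext (Equiv.ext fun ⟨m, a⟩ => ?_)⟩
    rw [h1, ← hk]
    rfl

end Voltage

end Cover

end SimplicialSurface

/-! ### An asymmetric surface of genus two -/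

namespace GenusTwo

/-- The vertex sets of the cells of a triangulated surface of genus two, as bit masks of eleven bits
each: first the 11 vertices, then the 39 edges, then the 26 faces. -/
def table : ℕ :=
  0xb01900e02602c144304418071111123029044881940640cc04609114120a42282510604f00500601200c04404805006022024018208110061021040280310110204404900901102104088090064024044084104204404805007001001001001001001001001001001

def mask (i : Fin 76) : ℕ := (table >>> (11 * i.val)) &&& 2047

def dim (i : Fin 76) : Fin 3 := if i.val < 11 then 0 else if i.val < 50 then 1 else 2

def Lt (a b : Fin 76) : Prop := dim a < dim b ∧ mask a &&& mask b = mask a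

instance : DecidableRel Lt := fun _ _ => inferInstanceAs (Decidable (_ ∧ _))

/-- The cyclically ordered faces at each vertex. -/
def link (v : Fin 76) : List (Fin 76) :=
  [[50, 51, 57, 53, 52, 54, 55, 58, 56], [50, 51, 63, 60, 59, 64, 62, 61], [52, 53, 66, 60, 59, 65],
    [54, 55, 69, 68, 67], [50, 56, 70, 68, 67, 61], [52, 54, 67, 61, 62, 71, 72, 65],
    [53, 57, 73, 71, 72, 74, 66], [51, 57, 73, 75, 63], [56, 58, 64, 62, 71, 73, 75, 70],
    [55, 58, 64, 59, 65, 72, 74, 69], [60, 63, 75, 70, 68, 69, 74, 66]].getD v.val []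

theorem edge_vertices : ∀ e, dim e = 1 → {v | dim v = 0 ∧ Lt v e}.ncard = 2 := by
  simp only [Set.ncard_eq_toFinset_card', Set.toFinset_ofPred]
  decide +kernel

theorem face_edges : ∀ f, dim f = 2 → {e | dim e = 1 ∧ Lt e f}.ncard = 3 := by
  simp only [Set.ncard_eq_toFinset_card', Set.toFinset_ofPred]
  decide +kernel

theorem face_vertices : ∀ f, dim f = 2 → {v | dim v = 0 ∧ Lt v f}.ncard = 3 := by
  simp only [Set.ncard_eq_toFinset_card', Set.toFinset_ofPred]
  decide +kernel

theorem face_corners : ∀ f v, dim f = 2 → dim v = 0 → Lt v f →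
    {e | dim e = 1 ∧ Lt e f ∧ Lt v e}.ncard = 2 := by
  simp only [Set.ncard_eq_toFinset_card', Set.toFinset_ofPred]
  decide +kernel

theorem edge_faces : ∀ e, dim e = 1 → {f | dim f = 2 ∧ Lt e f}.ncard = 2 := by
  simp only [Set.ncard_eq_toFinset_card', Set.toFinset_ofPred]
  decide +kernel

theorem link_spec : ∀ v, dim v = 0 → 3 ≤ (link v).length ∧ (link v).Nodup := by
  decide +kernel

theorem mem_link : ∀ v, dim v = 0 → ∀ f, f ∈ link v ↔ dim f = 2 ∧ Lt v f := by
  decide +kernel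

/-- The default in `getD` is never reached: both indices are below the length. -/
theorem link_adj : ∀ v, dim v = 0 → ∀ i < (link v).length, ∃ e, dim e = 1 ∧ Lt v e ∧
    Lt e ((link v).getD i 0) ∧ Lt e ((link v).getD ((i + 1) % (link v).length) 0) := by
  decide +kernel

theorem umbrella (v : Fin 76) (hv : dim v = 0) : ∃ n : ℕ, 3 ≤ n ∧ ∃ u : ZMod n → Fin 76,
    Function.Injective u ∧ Set.range u = {f | dim f = 2 ∧ Lt v f} ∧
    ∀ i, ∃ e, dim e = 1 ∧ Lt v e ∧ Lt e (u i) ∧ Lt e (u (i + 1)) := by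
  obtain ⟨h3, hnd⟩ := link_spec v hv
  have hmem := mem_link v hv
  have hadj := link_adj v hv
  generalize link v = l at h3 hnd hmem hadj
  have : NeZero l.length := ⟨by omega⟩
  refine ⟨l.length, h3, fun i => l[i.val]'(ZMod.val_lt i), fun i j hij => ?_, ?_, fun i => ?_⟩
  · exact ZMod.val_injective _ ((hnd.getElem_inj_iff).1 hij)
  · ext f
    rw [Set.mem_ofPred_eq, ← hmem, List.mem_iff_getElem]
    constructor
    · rintro ⟨i, rfl⟩
      exact ⟨_, ZMod.val_lt i, rfl⟩
    · rintro ⟨k, hk, rfl⟩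
      exact ⟨(k : ZMod l.length), by simp only [ZMod.val_natCast_of_lt hk]⟩
  · have : Fact (1 < l.length) := ⟨by omega⟩
    have h := hadj i.val (ZMod.val_lt i)
    rw [List.getD_eq_getElem _ _ (ZMod.val_lt i),
      List.getD_eq_getElem _ _ (Nat.mod_lt _ (by omega))] at h
    simpa only [ZMod.val_add, ZMod.val_one] using h

theorem dim_surjective : Function.Surjective dim := by
  decide +kernel

/-- A triangulated surface of genus two. -/
def surface : SimplicialSurface where
  carrier := Fin 76
  countable_carrier := inferInstance
  dim := dim
  dim_surjective := dim_surjective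
  lt := Lt
  dim_lt_of_lt _ _ h := h.1
  edge_vertices := edge_vertices
  face_edges := face_edges
  face_vertices := face_vertices
  face_corners := face_corners
  edge_faces := edge_faces
  umbrella := umbrella

theorem lt_trans : ∀ a b, Lt a b → ∀ c, Lt b c → Lt a c := by
  decide +kernel

theorem eq_of_vertices : ∀ a b, (∀ k : Fin 11,
    (Lt (k.castLE (by decide)) a ∨ k.castLE (by decide) = a) ↔
      (Lt (k.castLE (by decide)) b ∨ k.castLE (by decide) = b)) → a = b := by
  decide +kernel

theorem vertexFaithful : surface.VertexFaithful := fun a b h =>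
  eq_of_vertices a b fun k => by
    have hv : dim (k.castLE (by decide)) = 0 := if_pos k.isLt
    have := Set.ext_iff.1 h (k.castLE (by decide))
    change (dim _ = 0 ∧ (Lt _ a ∨ _ = a)) ↔ (dim _ = 0 ∧ (Lt _ b ∨ _ = b)) at this
    exact (and_congr_right_iff.1 this) hv

/-- The order in which the vertices can be recognized. -/
def rank (v : Fin 76) : ℕ := [0, 2, 1, 4, 3, 4, 0, 1, 2, 3, 2].getD v.val 0

/-- The search starts at vertices 0 and 6, the only ones of degrees 9 and 7. -/
theorem rank_spec : ∀ v, dim v = 0 → ∀ v', dim v' = 0 → (link v').length = (link v).length →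
    (∀ u, dim u = 0 → rank u < rank v → (∃ e, Lt u e ∧ Lt v e) → ∃ e, Lt u e ∧ Lt v' e) →
    v' = v := by
  decide +kernel

theorem degree_eq (v : Fin 76) (hv : dim v = 0) : surface.degree v = (link v).length := by
  have h : {f | dim f = 2 ∧ Lt v f} = ((link v).toFinset : Set (Fin 76)) := by
    ext f
    simp [mem_link v hv f]
  change Set.ncard {f | dim f = 2 ∧ Lt v f} = _
  rw [h, Set.ncard_coe_finset, List.toFinset_card_of_nodup (link_spec v hv).2]

/-- The least vertex of a cell, as a bit mask. -/
def anchor (a : Fin 76) : ℕ := mask a &&& (mask a ^^^ (mask a - 1))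

/-- The voltages of the covering surfaces: the letters `1` and `2` stand on the two handles. -/
def letter (a b : Fin 76) : Fin 3 :=
  -- The letter depends only on the least vertices. The masks encode `{6, 7, 10}` against `{0, 1,
  -- 2}` here, and `{8, 9, 10}` against `{0, 3, 4}` below.
  if anchor a &&& 1216 ≠ 0 ∧ anchor b &&& 7 ≠ 0 then 1
  else if anchor a &&& 1792 ≠ 0 ∧ anchor b &&& 25 ≠ 0 then 2 else 0

/-- One factor along a flag is always trivial, so multiplicativity holds for arbitrary permutations
`σ`, `τ`. -/
theorem letter_spec : ∀ a b, Lt a b → ∀ c, Lt b c →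
    letter a b = 0 ∧ letter b c = letter a c ∨ letter b c = 0 ∧ letter a b = letter a c := by
  decide +kernel

/-- These edges form a spanning tree of trivial voltages rooted at vertex 0. -/
theorem exists_lower_vertex : ∀ v, dim v = 0 → v ≠ 0 → ∃ u, u.val < v.val ∧ ∃ e, Lt u e ∧ Lt v e ∧
    letter u e = 0 ∧ letter v e = 0 := by
  decide +kernel

theorem exists_vertex : ∀ a, dim a = 0 ∨ ∃ v, dim v = 0 ∧ Lt v a ∧ letter v a = 0 := by
  decide +kernel

theorem exists_letter : ∀ k, ∃ a b, Lt a b ∧ letter a b = k := by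
  decide +kernel

theorem eq_of_letter_zero {α : Type*} (ψ : Fin 76 → α)
    (h : ∀ a b, Lt a b → letter a b = 0 → ψ a = ψ b) (a b : Fin 76) : ψ a = ψ b := by
  have hv : ∀ (n : ℕ) (v : Fin 76), v.val = n → dim v = 0 → ψ v = ψ 0 := by
    intro n
    induction n using Nat.strong_induction_on with
    | _ n ih =>
      rintro v rfl hv
      by_cases h0 : v = 0
      · rw [h0]
      · obtain ⟨u, hu, e, hue, hve, h1, h2⟩ := exists_lower_vertex v hv h0
        have hd : dim u = 0 := by
          simp only [dim] at hv ⊢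
          split_ifs at hv ⊢ <;> first | rfl | omega
        rw [h v e hve h2, ← h u e hue h1, ih _ hu u rfl hd]
  have key : ∀ a, ψ a = ψ 0 := fun a => by
    rcases exists_vertex a with ha | ⟨v, hv', hva, hl⟩
    · exact hv _ a rfl ha
    · rw [← h v a hva hl, hv _ v rfl hv']
  rw [key a, key b]

/-- The voltage assignment given by the permutations on the two handles. -/
def voltage {M : Type} (σ τ : Equiv.Perm M) : SimplicialSurface.Voltage surface M where
  toFun a b := ![1, σ, τ] (letter a b)
  mul_eq a b c hab hbc _ := by
    rcases letter_spec a b hab c hbc with ⟨h1, h2⟩ | ⟨h1, h2⟩ <;> simp [h1, h2]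

theorem snd_of_mem_Aut {M : Type} [Countable M] [Nonempty M] (w : SimplicialSurface.Voltage surface M)
    (φ : Equiv.Perm w.cover.carrier) (hφ : φ ∈ w.cover.Aut) (x : w.cover.carrier) :
    (φ x).2 = x.2 :=
  w.snd_of_mem_Aut vertexFaithful rank (fun v v' hv hv' hd h => rank_spec v hv v' hv'
    (by rw [← degree_eq v hv, ← degree_eq v' hv', hd]) h) hφ x

end GenusTwo

/-! ### Finite groups as centralizers of two permutations -/

theorem exists_surface_of_centralizer {M K : Type} [Finite M] [Nonempty M] [Group K]
    (σ τ : Equiv.Perm M) (ρ : K →* Equiv.Perm M) (hinj : Function.Injective ρ)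
    (hσ : ∀ k m, ρ k (σ m) = σ (ρ k m)) (hτ : ∀ k m, ρ k (τ m) = τ (ρ k m))
    (hsurj : ∀ ψ : M → M, (∀ m, ψ (σ m) = σ (ψ m)) → (∀ m, ψ (τ m) = τ (ψ m)) →
      ∃ k, ∀ m, ρ k m = ψ m)
    (htrans : ∀ {α : Type} (q : M → α), (∀ m, q (σ m) = q m) → (∀ m, q (τ m) = q m) →
      ∀ m m', q m = q m') :
    ∃ X : SimplicialSurface, Finite X.carrier ∧ X.Connected ∧ Nonempty (X.Aut ≃* K) ∧
      X.VertexFaithful := by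
  let w := GenusTwo.voltage σ τ
  have : Finite GenusTwo.surface.carrier := inferInstanceAs (Finite (Fin 76))
  have hw1 : ∀ a b, GenusTwo.letter a b = 0 → w.toFun a b = 1 := fun a b h => by
    simp [w, GenusTwo.voltage, h]
  have hall : ∀ Q : Equiv.Perm M → Prop, (∀ a b, GenusTwo.Lt a b → Q (w.toFun a b)) ↔
      Q 1 ∧ Q σ ∧ Q τ := by
    intro Q
    constructor
    · intro h
      refine ⟨?_, ?_, ?_⟩
      · obtain ⟨a, b, hab, hl⟩ := GenusTwo.exists_letter 0
        simpa [w, GenusTwo.voltage, hl] using h a b hab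
      · obtain ⟨a, b, hab, hl⟩ := GenusTwo.exists_letter 1
        simpa [w, GenusTwo.voltage, hl] using h a b hab
      · obtain ⟨a, b, hab, hl⟩ := GenusTwo.exists_letter 2
        simpa [w, GenusTwo.voltage, hl] using h a b hab
    · rintro ⟨h0, h1, h2⟩ a b -
      change Q (![1, σ, τ] (GenusTwo.letter a b))
      generalize GenusTwo.letter a b = k
      fin_cases k <;> assumption
  have hS : ∀ {α : Type} (ψ : GenusTwo.surface.carrier → α),
      (∀ a b, GenusTwo.surface.lt a b → w.toFun a b = 1 → ψ a = ψ b) → ∀ a b, ψ a = ψ b :=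
    fun ψ h => GenusTwo.eq_of_letter_zero ψ fun a b hab hl => h a b hab (hw1 a b hl)
  refine ⟨w.cover, w.finite_cover, ?_, ?_, w.vertexFaithful_cover GenusTwo.vertexFaithful⟩
  · refine w.connected_cover (fun a b c hab hbc => GenusTwo.lt_trans a b hab c hbc) hS
      fun q hq => ?_
    have := (hall fun p => ∀ m, q (p m) = q m).1 fun a b hab m => hq a b m hab
    exact htrans q this.2.1 this.2.2
  · refine w.nonempty_Aut_cover_mulEquiv ρ hinj (fun k a b m hab => ?_) (fun ψ hψ => ?_) hS
      (GenusTwo.snd_of_mem_Aut w)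
    · exact (hall fun p => ∀ m, ρ k (p m) = p (ρ k m)).2 ⟨fun _ => rfl, hσ k, hτ k⟩ a b hab m
    · have := (hall fun p => ∀ m, ψ (p m) = p (ψ m)).1 fun a b hab m => hψ a b m hab
      exact hsurj ψ this.2.1 this.2.2

theorem exists_surface_of_finite_group (K : Type) [Group K] [Finite K] :
    ∃ X : SimplicialSurface, Finite X.carrier ∧ X.Connected ∧ Nonempty (X.Aut ≃* K) ∧
      X.VertexFaithful := by
  classical
  have := Fintype.ofFinite K
  -- `c` permutes all of `K` in a single cycle, so `σ` is transitive on every row `{h} × K`.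
  obtain ⟨c, hc, -⟩ := (Finset.univ : Finset K).exists_cycleOn
  let σ : Equiv.Perm (K × K) := Equiv.prodCongr (Equiv.refl K) c
  let τ : Equiv.Perm (K × K) :=
    { toFun := fun m => (m.1 * m.2, m.2)
      invFun := fun m => (m.1 * m.2⁻¹, m.2)
      left_inv := fun m => by simp
      right_inv := fun m => by simp }
  let ρ : K →* Equiv.Perm (K × K) :=
    { toFun := fun k => Equiv.prodCongr (Equiv.mulLeft k) (Equiv.refl K)
      map_one' := Equiv.ext fun m => by simp
      map_mul' := fun k l => Equiv.ext fun m => Prod.ext (mul_assoc k l m.1) rfl }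
  have hσ : ∀ k m, ρ k (σ m) = σ (ρ k m) := fun k m => rfl
  have hτ : ∀ k m, ρ k (τ m) = τ (ρ k m) := fun k m =>
    Prod.ext (mul_assoc k m.1 m.2).symm rfl
  have htrans : ∀ {α : Type} (q : K × K → α), (∀ m, q (σ m) = q m) → (∀ m, q (τ m) = q m) →
      ∀ m m', q m = q m' := by
    intro α q h1 h2
    have hrow : ∀ h x y, q (h, x) = q (h, y) := by
      intro h x y
      obtain ⟨i, hi⟩ := (hc.2 (Finset.mem_coe.2 (Finset.mem_univ x))
        (Finset.mem_coe.2 (Finset.mem_univ y))).exists_nat_pow_eq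
      have key : ∀ i : ℕ, q (h, (c ^ i) x) = q (h, x) := by
        intro i
        induction i with
        | zero => rfl
        | succ i ih =>
          rw [pow_succ', Equiv.Perm.mul_apply, ← ih]
          exact h1 (h, (c ^ i) x)
      rw [← hi, key]
    have hone : ∀ m, q m = q (1, 1) := by
      rintro ⟨h, x⟩
      -- Within row `h`, move to `(h, h⁻¹)`, which `τ` carries into row 1.
      rw [hrow h x h⁻¹, ← h2, hrow 1 1 h⁻¹]
      exact congrArg q (Prod.ext (mul_inv_cancel h) rfl)
    intro m m'
    rw [hone m, hone m']
  refine exists_surface_of_centralizer σ τ ρ (fun k l hkl => ?_) hσ hτ (fun ψ h1 h2 => ?_) htrans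
  · have h := (Prod.ext_iff.1 (DFunLike.congr_fun hkl (1, 1))).1
    simpa [ρ] using h
  -- The fixed points of `τ` are exactly the pairs `(h, 1)`, and `ψ` preserves them.
  · have hfix : (ψ (1, 1)).2 = 1 := by
      have h := (Prod.ext_iff.1 (h2 (1, 1))).1
      rw [show τ (1, 1) = (1, 1) from Prod.ext (mul_one 1) rfl] at h
      exact left_eq_mul.1 h
    refine ⟨(ψ (1, 1)).1, fun m => ?_⟩
    -- Transitivity is used with `α = Prop`: the set where the two maps agree is invariant and
    -- contains `(1, 1)`.
    have h := htrans (fun m => ρ (ψ (1, 1)).1 m = ψ m)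
      (fun m => by rw [hσ, h1, σ.injective.eq_iff]) (fun m => by rw [hτ, h2, τ.injective.eq_iff])
      m (1, 1)
    exact h.mpr (Prod.ext (mul_one _) hfix.symm)

theorem mainTheorem3 {G : Type*} [Group G] [Finite G] (n : ℕ) (g : Fin n → G)
    (hg : Subgroup.closure (Set.range g) = ⊤) :
    ∃ X : SimplicialSurface,
      Finite X.carrier ∧ X.Connected ∧
      Nonempty (X.Aut ≃* G) ∧
      ((∀ i : Fin n, Subgroup.zpowers (g i) ⊓ Subgroup.zpowers (List.ofFn g).prod = ⊥) →
        X.VertexFaithful) := by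
  -- Carriers of surfaces live in `Type`, so `G` is first replaced by a copy there.
  obtain ⟨K, ⟨E⟩⟩ : ∃ K : Type, Nonempty (K ≃ G) := ⟨_, ⟨(Finite.equivFin G).symm⟩⟩
  let _ : Group K := E.group
  have : Finite K := Finite.of_equiv G E.symm
  obtain ⟨X, h1, h2, ⟨h3⟩, h4⟩ := exists_surface_of_finite_group K
  exact ⟨X, h1, h2, ⟨h3.trans E.mulEquiv⟩, fun _ => h4⟩
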